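/- Work over the universe $V$ of sets, which satisfies $\mathsf{ZFC}$. Let $A$ and $B\neq\emptyset$ be sets. Let the $\lambda_c$-terms (modulo $\alpha$-equivalence) and stacks be given by $$t,s ::= x \mid ts \mid \lambda x.\,t \mid \mathsf{cc} \mid \mathsf{k}_\pi \mid \xi_\alpha\ (\alpha\in A),\qquad \pi ::= \omega_\beta\ (\beta\in B)\mid t\cdot\pi\ (t \text{ closed}).$$ Let $\Lambda$ be the set of closed terms, $\Pi$ the set of stacks, and $\mathcal R\subseteq\Lambda$ the set of realizers, i.e. closed terms containing no continuation constant $\mathsf k_\pi$. Let $\mathcal A=(A,B,\prec,\bot\!\!\!\bot)$ be a realizability algebra: $\prec$ is a preorder on $\Lambda\times\Pi$ (whose elements are written $t\star\pi$) such that $$ts\star\pi\succ t\star s\cdot\pi,\quad \lambda u.t\star s\cdot\pi\succ t[u:=s]\star\pi,\quad \mathsf{cc}\star t\cdot\pi\succ t\star\mathsf k_\pi\cdot\pi,\quad \mathsf k_\sigma\star t\cdot\pi\succ t\star\sigma,$$ and $\bot\!\!\!\bot\subseteq\Lambda\times\Pi$ is such that $p\succ q\in\bot\!\!\!\bot$ implies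 $p\in\bot\!\!\!\bot$. The class $\mathbf N$ of names consists of the sets that are hereditarily sets of pairs (name, stack), i.e. $\mathbf N=\bigcup_\alpha \mathbf N_\alpha$ with $\mathbf N_\alpha=\bigcup_{\beta<\alpha}\mathcal P(\mathbf N_\beta\times\Pi)$. For a set $x$ the recursive name $ℸx$ is $\{(ℸy,\pi) : y\in x,\ \pi\in\Pi\}$. To closed formulas over the relation symbols $\notin,\subseteq,\not\mathrel{\varepsilon},\neq$ with parameters in $\mathbf N$, built with $\top,\bot,\to,\forall$ (the other connectives being De Morgan abbreviations), one assigns falsity values $\|\varphi\|\subseteq\Pi$ and truth values $|\varphi|=\{t\in\Lambda:\forall\pi\in\|\varphi\|\ t\star\pi\in\bot\!\!\!\bot\}$ by - $\|\top\|=\emptyset$, $\|\bot\|=\Pi$, $\|a\not\mathrel{\varepsilon} b\|=\{\pi:(a,\pi)\in b\}$, and $\|a\ne b\|$ is $\emptyset$ if $a\neq b$ and $\Pi$ if $a=b$; - $\|a\notin b\|=\{t\cdot t'\cdot\pi : \exists c\,((c,\pi)\in b,\ t\in|a\subseteq c|,\ t'\in|c\subseteq a|)\}$; - $\|a\subseteq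 b\|=\{t\cdot\pi : \exists c\,((c,\pi)\in a,\ t\in|c\notin b|)\}$; - $\|\psi\to\theta\|=\{t\cdot\pi : t\in|\psi|,\ \pi\in\|\theta\|\}$ and $\|\forall x\,\varphi(x)\|=\bigcup_{a\in\mathbf N}\|\varphi(a)\|$. Write $\mathcal N\Vdash\varphi$ if $|\varphi|\cap\mathcal R\neq\emptyset$. In this language $a\in b$ means $a\notin b\to\bot$, and $a\simeq b$ means $a\subseteq b\wedge b\subseteq a$. Say that $a$ is an $\in$-cardinal if $a$ is an $\in$-transitive set of $\in$-transitive sets and for no $b\in a$ is there an $f$ such that $f$ is an $\in$-function with domain $b$ (that is, $\forall x\in b\,\exists y\,\langle x,y\rangle\in f$, and $\forall x\in b\,\forall y,y'(\langle x,y\rangle\in f\wedge\langle x,y'\rangle\in f\to y\simeq y')$) and $f$ is onto $a$ (that is, $\forall y\in a\,\exists x\in b\,\langle x,y\rangle\in f$). Here everything is expressed with $\in$ and $\simeq$, and $\langle x,y\rangle$ is the Wiener pair $\{\{\{x\},\emptyset\},\{\{y\}\}\}$. **Theorem.** For every infinite cardinal $\delta>|\Lambda|$, regular or singular, $\mathcal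 N\Vdash\text{“}ℸδ\text{ is an }\in\text{-cardinal”}$. -/

import Mathlib

universe u

namespace Realizability

/-! ### Terms, stacks and evaluation of the lambda-c-calculus -/

mutual

/-- `Term A B n`: the `λ_c`-terms (modulo α-equivalence, in de Bruijn style) whose free variables
are among `n` given ones, with special instructions indexed by `A` and stack bottoms by `B`. -/
inductive Term (A B : Type u) : ℕ → Type u
  | var {n : ℕ} (i : Fin n) : Term A B n
  | app {n : ℕ} (t s : Term A B n) : Term A B n
  | lam {n : ℕ} (t : Term A B (n + 1)) : Term A B n
  | cc {n : ℕ} : Term A B n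
  | kont {n : ℕ} (π : Stack A B) : Term A B n
  | instr {n : ℕ} (α : A) : Term A B n

/-- Stacks: a list of closed terms ended by a stack bottom. -/
inductive Stack (A B : Type u) : Type u
  | bottom (β : B) : Stack A B
  | push (t : Term A B 0) (π : Stack A B) : Stack A B

end

/-- The set `Λ` of closed `λ_c`-terms. -/
abbrev Closed (A B : Type u) : Type u := Term A B 0

namespace Term

variable {A B : Type u}

/-- Renaming of free variables. -/
def rename : {n m : ℕ} → (Fin n → Fin m) → Term A B n → Term A B m
  | _, _, ρ, var i => var (ρ i)
  | _, _, ρ, app t s => app (rename ρ t) (rename ρ s)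
  | _, _, ρ, lam t => lam (rename (Fin.cases 0 fun i => (ρ i).succ) t)
  | _, _, _, cc => cc
  | _, _, _, kont π => kont π
  | _, _, _, instr α => instr α

/-- Simultaneous capture-avoiding substitution (the variable bound by `lam` is number `0`). -/
def subst : {n m : ℕ} → (Fin n → Term A B m) → Term A B n → Term A B m
  | _, _, σ, var i => σ i
  | _, _, σ, app t s => app (subst σ t) (subst σ s)
  | _, _, σ, lam t => lam (subst (Fin.cases (var 0) fun i => rename Fin.succ (σ i)) t)
  | _, _, _, cc => cc
  | _, _, _, kont π => kont π
  | _, _, _, instr α => instr α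

/-- `t[u := s]`, where `u` is the only free variable of `t` and `s` is closed. -/
def inst (t : Term A B 1) (s : Term A B 0) : Term A B 0 := subst (fun _ => s) t

/-- The term contains no continuation constant. -/
def KontFree : {n : ℕ} → Term A B n → Prop
  | _, var _ => True
  | _, app t s => KontFree t ∧ KontFree s
  | _, lam t => KontFree t
  | _, cc => True
  | _, kont _ => False
  | _, instr _ => True

end Term

/-- The set `R` of realizers: closed terms without continuation constants. -/
def realizers (A B : Type u) : Set (Closed A B) := {t | t.KontFree}

open Term Stack in
/-- The four evaluation rules; `Step p q` means that the pair `p` of a closed term and a stack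
evaluates to the pair `q` in one step. -/
inductive Step {A B : Type u} : Closed A B × Stack A B → Closed A B × Stack A B → Prop
  | push (t s : Closed A B) (π : Stack A B) : Step (app t s, π) (t, push s π)
  | grab (t : Term A B 1) (s : Closed A B) (π : Stack A B) :
      Step (lam t, push s π) (t.inst s, π)
  | save (t : Closed A B) (π : Stack A B) : Step (cc, push t π) (t, push (kont π) π)
  | restore (t : Closed A B) (π σ : Stack A B) : Step (kont σ, push t π) (t, σ)

/-- A realizability algebra: sets `A` (special instructions) and `B ≠ ∅` (stack bottoms), a preorder
`p ≻ q` (written `red p q`) on `Λ × Π` extending the evaluation preorder (the least preorder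
containing `Step`), and a pole that is closed under anti-evaluation. -/
structure Algebra where
  A : Type u
  B : Type u
  nonempty_B : Nonempty B
  red : Closed A B × Stack A B → Closed A B × Stack A B → Prop
  red_refl : ∀ p, red p p
  red_trans : ∀ p q r, red p q → red q r → red p r
  red_of_step : ∀ p q, Step p q → red p q
  pole : Set (Closed A B × Stack A B)
  pole_closed : ∀ p q, red p q → q ∈ pole → p ∈ pole

/-- `Λ`. -/
abbrev Algebra.Lam (𝒜 : Algebra.{u}) : Type u := Closed 𝒜.A 𝒜.B

/-- `Π`. -/
abbrev Algebra.Stk (𝒜 : Algebra.{u}) : Type u := Stack 𝒜.A 𝒜.B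

/-! ### Names

The ground model is the universe `ZFSet.{u}`, whose sets correspond to the types in `Type u`. A name
is, hereditarily, a set of pairs (name, stack). As for `PSet` and `ZFSet`, names are built as a
quotient of well-founded trees by extensional equality. -/

/-- Presentations of names: families, indexed by a small type, of pairs (presentation, element of
`P`). -/
inductive PreName (P : Type u) : Type (u + 1)
  | mk (ι : Type u) (el : ι → PreName P) (st : ι → P) : PreName P

namespace PreName

variable {P : Type u}

/-- Two presentations describe the same hereditary set of pairs. -/
def Equiv : PreName P → PreName P → Prop
  | mk ι el st, mk ι' el' st' =>
    (∀ i : ι, ∃ j : ι', Equiv (el i) (el' j) ∧ st i = st' j) ∧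
    (∀ j : ι', ∃ i : ι, Equiv (el i) (el' j) ∧ st i = st' j)

theorem Equiv.refl : ∀ a : PreName P, Equiv a a
  | mk _ el _ => ⟨fun i => ⟨i, Equiv.refl (el i), rfl⟩, fun i => ⟨i, Equiv.refl (el i), rfl⟩⟩

theorem Equiv.symm : ∀ {a b : PreName P}, Equiv a b → Equiv b a
  | mk _ _ _, mk _ _ _, ⟨h₁, h₂⟩ =>
    ⟨fun j => (h₂ j).elim fun i h => ⟨i, Equiv.symm h.1, h.2.symm⟩,
     fun i => (h₁ i).elim fun j h => ⟨j, Equiv.symm h.1, h.2.symm⟩⟩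

theorem Equiv.trans : ∀ {a b c : PreName P}, Equiv a b → Equiv b c → Equiv a c
  | mk _ _ _, mk _ _ _, mk _ _ _, ⟨h₁, h₂⟩, ⟨k₁, k₂⟩ =>
    ⟨fun i => (h₁ i).elim fun j h => (k₁ j).elim fun l k =>
        ⟨l, Equiv.trans h.1 k.1, h.2.trans k.2⟩,
     fun l => (k₂ l).elim fun j k => (h₂ j).elim fun i h =>
        ⟨i, Equiv.trans h.1 k.1, h.2.trans k.2⟩⟩

instance setoid (P : Type u) : Setoid (PreName P) :=
  ⟨Equiv, Equiv.refl, Equiv.symm, Equiv.trans⟩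

/-- `(c, π)` is an element of the set described by `a`. -/
def Mem (c : PreName P) (π : P) : PreName P → Prop
  | mk _ el st => ∃ i, Equiv c (el i) ∧ π = st i

theorem Mem.congr {c c' a a' : PreName P} {π : P} (hc : Equiv c c') (ha : Equiv a a')
    (h : Mem c π a) : Mem c' π a' := by
  cases a with | mk ι el st =>
  cases a' with | mk ι' el' st' =>
  obtain ⟨i, hi, rfl⟩ := h
  obtain ⟨j, hj, hst⟩ := ha.1 i
  exact ⟨j, hc.symm.trans (hi.trans hj), hst⟩

end PreName

/-- The class of names over the set `P` of stacks. -/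
def Name (P : Type u) : Type (u + 1) := Quotient (PreName.setoid P)

namespace Name

variable {P : Type u}

/-- `Mem c π a` means `(c, π) ∈ a`. -/
def Mem (c : Name P) (π : P) (a : Name P) : Prop :=
  Quotient.liftOn₂ c a (fun c a => PreName.Mem c π a) fun _ _ _ _ hc ha =>
    propext ⟨PreName.Mem.congr hc ha, PreName.Mem.congr hc.symm ha.symm⟩

/-- `c ∈ dom(a)`. -/
def InDom (c a : Name P) : Prop := ∃ π, Mem c π a

/-- Names are sets: two names with the same elements are equal. -/
theorem ext {a b : Name P} (h : ∀ c π, Mem c π a ↔ Mem c π b) : a = b := by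
  induction a using Quotient.inductionOn with | h a =>
  induction b using Quotient.inductionOn with | h b =>
  apply Quotient.sound
  cases a with | mk ι el st =>
  cases b with | mk ι' el' st' =>
  refine ⟨fun i => ?_, fun j => ?_⟩
  · exact (h (Quotient.mk _ (el i)) (st i)).1 ⟨i, PreName.Equiv.refl _, rfl⟩
  · obtain ⟨i, hi, hs⟩ := (h (Quotient.mk _ (el' j)) (st' j)).2 ⟨j, PreName.Equiv.refl _, rfl⟩
    exact ⟨i, hi.symm, hs.symm⟩

/-- Every (small) set of pairs (name, stack) is a name. -/
theorem exists_mem_iff (S : Set (Name P × P)) [Small.{u} S] :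
    ∃ a : Name P, ∀ c π, Mem c π a ↔ (c, π) ∈ S := by
  let e : Shrink.{u} S → S := (equivShrink S).symm
  refine ⟨Quotient.mk _ (PreName.mk (Shrink.{u} S) (fun i => (e i).1.1.out)
    (fun i => (e i).1.2)), fun c π => ?_⟩
  induction c using Quotient.inductionOn with | h c =>
  constructor
  · rintro ⟨i, hi, rfl⟩
    have : (Quotient.mk _ c : Name P) = (e i).1.1 :=
      (Quotient.sound hi).trans (Quotient.out_eq _)
    rw [this]
    exact (e i).2
  · intro h
    refine ⟨equivShrink S ⟨_, h⟩, ?_, ?_⟩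
    · simp only [e, Equiv.symm_apply_apply]
      exact Quotient.exact (s := PreName.setoid P) (Quotient.out_eq (Quotient.mk _ c)).symm
    · simp [e]

/-- The name whose elements are the members of a given (small) set of pairs (name, stack). -/
noncomputable def ofSet (S : Set (Name P × P)) [Small.{u} S] : Name P :=
  (exists_mem_iff S).choose

theorem mem_ofSet (S : Set (Name P × P)) [Small.{u} S] (c : Name P) (π : P) :
    Mem c π (ofSet S) ↔ (c, π) ∈ S :=
  (exists_mem_iff S).choose_spec c π

/-- `InDom` is well founded. -/
theorem inDom_wf : WellFounded (InDom (P := P)) := by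
  refine ⟨fun a => ?_⟩
  induction a using Quotient.inductionOn with | h a =>
  induction a with | mk ι el st ih =>
  refine ⟨_, fun c hc => ?_⟩
  induction c using Quotient.inductionOn with | h c =>
  obtain ⟨π, i, hi, -⟩ := hc
  have : (Quotient.mk _ c : Name P) = Quotient.mk _ (el i) := Quotient.sound hi
  rw [this]
  exact ih i

instance : WellFoundedRelation (Sym2 (Name P)) :=
  ⟨Sym2.GameAdd InDom, inDom_wf.sym2_gameAdd⟩

end Name

/-- The recursive ("reish") name of a set `x` of the ground model:
the set of all pairs `(reish y, π)` with `y ∈ x` and `π` a stack. -/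
noncomputable def reish (P : Type u) (x : ZFSet.{u}) : Name P :=
  Name.ofSet (Set.range fun q : {y : ZFSet.{u} // y ∈ x} × P => (reish P q.1.1, q.2))
termination_by x
decreasing_by exact q.1.2

/-! ### The language of `ZF_ε` and its realizability interpretation -/

/-- Formulas over the primitive binary relations `∉`, `⊆`, `ε̸`, `≠` (without function symbols), with
variables named by natural numbers. -/
inductive Fml : Type
  | top : Fml
  | bot : Fml
  | notMem (x y : ℕ) : Fml
  | sub (x y : ℕ) : Fml
  | notEps (x y : ℕ) : Fml
  | ne (x y : ℕ) : Fml
  | imp (φ ψ : Fml) : Fml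
  | all (x : ℕ) (φ : Fml) : Fml

namespace Algebra

variable (𝒜 : Algebra.{u})

/-- The class of names for the algebra `𝒜`. -/
abbrev Names : Type (u + 1) := Name 𝒜.Stk

/-- The truth value determined by a falsity value. -/
def verity (S : Set 𝒜.Stk) : Set 𝒜.Lam := {t | ∀ π ∈ S, (t, π) ∈ 𝒜.pole}

mutual

/-- The falsity value of `a ∉ b`. -/
def falsityNotMem (a b : 𝒜.Names) : Set 𝒜.Stk :=
  {ρ | ∃ (c : 𝒜.Names) (π : 𝒜.Stk) (t t' : 𝒜.Lam), ∃ _ : Name.Mem c π b,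
    t ∈ 𝒜.verity (falsitySub a c) ∧ t' ∈ 𝒜.verity (falsitySub c a) ∧
      ρ = .push t (.push t' π)}
termination_by s(a, b)
decreasing_by
  · exact Sym2.GameAdd.snd (rα := Name.InDom) ⟨π, ‹Name.Mem c π b›⟩
  · exact Sym2.GameAdd.fst_snd (rα := Name.InDom) ⟨π, ‹Name.Mem c π b›⟩

/-- The falsity value of `a ⊆ b`. -/
def falsitySub (a b : 𝒜.Names) : Set 𝒜.Stk :=
  {ρ | ∃ (c : 𝒜.Names) (π : 𝒜.Stk) (t : 𝒜.Lam), ∃ _ : Name.Mem c π a,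
    t ∈ 𝒜.verity (falsityNotMem c b) ∧ ρ = .push t π}
termination_by s(a, b)
decreasing_by exact Sym2.GameAdd.fst (rα := Name.InDom) ⟨π, ‹Name.Mem c π a›⟩

end

/-- The falsity value of the formula `φ`, whose free variables are interpreted by the names `v`. -/
def falsity : Fml → (ℕ → 𝒜.Names) → Set 𝒜.Stk
  | .top, _ => ∅
  | .bot, _ => Set.univ
  | .notMem x y, v => 𝒜.falsityNotMem (v x) (v y)
  | .sub x y, v => 𝒜.falsitySub (v x) (v y)
  | .notEps x y, v => {π | Name.Mem (v x) π (v y)}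
  | .ne x y, v => {_π | v x = v y}
  | .imp φ ψ, v => {ρ | ∃ t ∈ 𝒜.verity (falsity φ v), ∃ π ∈ falsity ψ v, ρ = .push t π}
  | .all x φ, v => ⋃ a : 𝒜.Names, falsity φ (Function.update v x a)

/-- `t ⊩ φ`. -/
def Realizes (t : 𝒜.Lam) (φ : Fml) (v : ℕ → 𝒜.Names) : Prop := t ∈ 𝒜.verity (𝒜.falsity φ v)

/-- `𝒩 ⊩ φ`: the formula `φ`, with parameters `v`, belongs to the realizability theory, that is, it is
realized by a realizer. -/
def Forces (φ : Fml) (v : ℕ → 𝒜.Names) : Prop :=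
  ∃ t ∈ realizers 𝒜.A 𝒜.B, 𝒜.Realizes t φ v

end Algebra

/-! ### Formulas expressing that a set is a cardinal

In the definitions below, `k` is a number such that the variables `k, k + 1, …` are fresh: they are
used as bound variables. All these formulas are in the language of `∈` and `≃`. -/

namespace Fml

def neg (φ : Fml) : Fml := imp φ bot

def and (φ ψ : Fml) : Fml := imp (imp φ (imp ψ bot)) bot

def or (φ ψ : Fml) : Fml := imp (imp φ bot) (imp (imp ψ bot) bot)

def iff (φ ψ : Fml) : Fml := and (imp φ ψ) (imp ψ φ)

def ex (x : ℕ) (φ : Fml) : Fml := imp (all x (imp φ bot)) bot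

/-- `x ∈ y` -/
def mem (x y : ℕ) : Fml := imp (notMem x y) bot

/-- `x ≃ y` -/
def eqv (x y : ℕ) : Fml := and (sub x y) (sub y x)

/-- `∀ x ∈ a, φ` -/
def allIn (x a : ℕ) (φ : Fml) : Fml := all x (imp (mem x a) φ)

/-- `∃ x ∈ a, φ` -/
def exIn (x a : ℕ) (φ : Fml) : Fml := ex x (and (mem x a) φ)

/-- `z` is empty. -/
def isEmpty (k z : ℕ) : Fml := all k (neg (mem k z))

/-- `s ≃ {x}` -/
def isSingleton (k s x : ℕ) : Fml := all k (iff (mem k s) (eqv k x))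

/-- `s ≃ {x, y}` -/
def isPair (k s x y : ℕ) : Fml := all k (iff (mem k s) (or (eqv k x) (eqv k y)))

/-- `p` is the (Wiener) ordered pair `⟨x, y⟩ = {{{x}, ∅}, {{y}}}`. -/
def isOrderedPair (k p x y : ℕ) : Fml :=
  ex k (ex (k + 1) (ex (k + 2) (ex (k + 3) (ex (k + 4)
    (and (isSingleton (k + 5) k x)
    (and (isEmpty (k + 5) (k + 1))
    (and (isPair (k + 5) (k + 2) k (k + 1))
    (and (isSingleton (k + 5) (k + 3) y)
    (and (isSingleton (k + 5) (k + 4) (k + 3))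
      (isPair (k + 5) p (k + 2) (k + 4)))))))))))

/-- `⟨x, y⟩ ∈ f`, also written `f(x, y)`. -/
def related (k f x y : ℕ) : Fml := exIn k f (isOrderedPair (k + 1) k x y)

/-- `f` is an `∈`-function with domain `b`. -/
def isFunction (k f b : ℕ) : Fml :=
  and (allIn k b (ex (k + 1) (related (k + 2) f k (k + 1))))
    (allIn k b (all (k + 1) (all (k + 2)
      (imp (and (related (k + 3) f k (k + 1)) (related (k + 3) f k (k + 2)))
        (eqv (k + 1) (k + 2))))))

/-- Every `y ∈ a` is the value of `f` at some `x ∈ b`. -/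
def isSurjection (k f b a : ℕ) : Fml :=
  allIn k a (exIn (k + 1) b (related (k + 2) f (k + 1) k))

/-- `a` is `∈`-transitive. -/
def isTransitive (k a : ℕ) : Fml := allIn k a (allIn (k + 1) k (mem (k + 1) a))

/-- `a` is an `∈`-ordinal: an `∈`-transitive set of `∈`-transitive sets. -/
def isOrdinal (k a : ℕ) : Fml := and (isTransitive k a) (allIn k a (isTransitive (k + 1) k))

/-- `a` is an `∈`-cardinal: an `∈`-ordinal such that no `∈`-function maps some `b ∈ a` onto `a`. -/
def isCardinal (k a : ℕ) : Fml :=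
  and (isOrdinal k a)
    (allIn k a (neg (ex (k + 1)
      (and (isFunction (k + 2) (k + 1) k) (isSurjection (k + 2) (k + 1) k a)))))

end Fml

end Realizability

namespace Realizability

/-! ### Substitution lemmas -/

namespace Term

variable {A B : Type u}

-- Suppose `f` is a function with domain `b`, where `b ≃ ℸβ` with `β < δ`, and `f` is onto `ℸδ`. A
-- stack `π` in the falsity value of `f(ℸγ, ℸη) → ⊥` is treated as a colour of the triple `(γ, π,
-- η)`. There are at most `|β|·|Π|` pairs `(γ, π)`, and `|Π| ≤ |Λ| < δ`. A supremum of chosen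
-- witnesses then gives `η < δ` such that every colour present at `η` already occurs at some `η' <
-- η` (`exists_ordinal_reflecting`). The supremum is taken below a successor cardinal `κ⁺ ≤ δ`, so
-- regularity of `δ` plays no role.
--
-- For this `η`, a term that realizes `f(ℸγ, ℸη') → ⊥` for all `η' < η` also realizes `f(ℸγ, ℸη) →
-- ⊥`. Given a realizer of `f(ℸγ, ℸη)`, uniqueness of values provides such a term: `f(ℸγ, ℸη')`
-- would give `ℸη ⊆ ℸη'`, impossible since `η' ∈ η` (`rz_clash`). Surjectivity at `ℸη` yields `f(x,
-- ℸη)` for some `x ≃ ℸγ`, hence a contradiction (`rz_noSurj`). The realizer mentions none of `β`,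
-- `γ`, `η`, `η'`.
--
-- The rest is the extensional theory of `⊆` and `∈`, realized through a fixed point combinator
-- (`rz_fixpt`), and congruence of `f(x, y)` in `x` (`rz_relCongr`).

theorem subst_rename : ∀ {n m l : ℕ} (ρ : Fin n → Fin m) (σ : Fin m → Term A B l)
    (t : Term A B n), subst σ (rename ρ t) = subst (fun i => σ (ρ i)) t
  | _, _, _, _, _, var _ => rfl
  | _, _, _, ρ, σ, app t s => by simp only [rename, subst, subst_rename ρ σ]
  | _, _, _, ρ, σ, lam t => by
    simp only [rename, subst, subst_rename]
    congr 2
    funext i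
    cases i using Fin.cases <;> rfl
  | _, _, _, _, _, cc => rfl
  | _, _, _, _, _, kont _ => rfl
  | _, _, _, _, _, instr _ => rfl

theorem rename_rename : ∀ {n m l : ℕ} (ρ : Fin n → Fin m) (σ : Fin m → Fin l)
    (t : Term A B n), rename σ (rename ρ t) = rename (fun i => σ (ρ i)) t
  | _, _, _, _, _, var _ => rfl
  | _, _, _, ρ, σ, app t s => by simp only [rename, rename_rename ρ σ]
  | _, _, _, ρ, σ, lam t => by
    simp only [rename, rename_rename]
    congr 2
    funext i
    cases i using Fin.cases <;> rfl
  | _, _, _, _, _, cc => rfl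
  | _, _, _, _, _, kont _ => rfl
  | _, _, _, _, _, instr _ => rfl

theorem rename_subst : ∀ {n m l : ℕ} (σ : Fin n → Term A B m) (ρ : Fin m → Fin l)
    (t : Term A B n), rename ρ (subst σ t) = subst (fun i => rename ρ (σ i)) t
  | _, _, _, _, _, var _ => rfl
  | _, _, _, σ, ρ, app t s => by simp only [rename, subst, rename_subst σ ρ]
  | _, _, _, σ, ρ, lam t => by
    simp only [rename, subst, rename_subst]
    congr 2
    funext i
    cases i using Fin.cases
    · rfl
    · simp only [Fin.cases_succ, rename_rename]
  | _, _, _, _, _, cc => rfl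
  | _, _, _, _, _, kont _ => rfl
  | _, _, _, _, _, instr _ => rfl

theorem subst_subst : ∀ {n m l : ℕ} (σ : Fin n → Term A B m) (τ : Fin m → Term A B l)
    (t : Term A B n), subst τ (subst σ t) = subst (fun i => subst τ (σ i)) t
  | _, _, _, _, _, var _ => rfl
  | _, _, _, σ, τ, app t s => by simp only [subst, subst_subst σ τ]
  | _, _, _, σ, τ, lam t => by
    simp only [subst, subst_subst]
    congr 2
    funext i
    cases i using Fin.cases
    · rfl
    · simp only [Fin.cases_succ, rename_subst, subst_rename]
  | _, _, _, _, _, cc => rfl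
  | _, _, _, _, _, kont _ => rfl
  | _, _, _, _, _, instr _ => rfl

theorem subst_var : ∀ {n : ℕ} (t : Term A B n), subst var t = t
  | _, var _ => rfl
  | _, app t s => by simp only [subst, subst_var]
  | _, lam t => by
    simp only [subst]
    congr 1
    refine Eq.trans ?_ (subst_var t)
    congr 1
    funext i
    cases i using Fin.cases <;> rfl
  | _, cc => rfl
  | _, kont _ => rfl
  | _, instr _ => rfl

theorem subst_closed (σ : Fin 0 → Closed A B) (t : Closed A B) : subst σ t = t := by
  rw [Subsingleton.elim σ var, subst_var]

/-- A closed term, seen as a term with `n` free variables. -/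
def up {n : ℕ} (t : Closed A B) : Term A B n := rename Fin.elim0 t

theorem subst_up {n : ℕ} (σ : Fin n → Closed A B) (t : Closed A B) : subst σ (up t) = t := by
  rw [up, subst_rename, subst_closed]

/-- A β-step under a closing environment just extends the environment; this is what makes `rz_lam` a
typing rule for open bodies. -/
theorem inst_subst_lift {n : ℕ} (σ : Fin n → Closed A B) (t : Term A B (n + 1))
    (s : Closed A B) :
    (subst (Fin.cases (var 0) fun i => rename Fin.succ (σ i)) t).inst s =
      subst (Matrix.vecCons s σ) t := by
  rw [inst, subst_subst]
  congr 1
  funext i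
  cases i using Fin.cases
  · rfl
  · simp only [Fin.cases_succ, subst_rename, Matrix.cons_val_succ, subst_closed]

theorem kontFree_rename : ∀ {n m : ℕ} (ρ : Fin n → Fin m) (t : Term A B n),
    (rename ρ t).KontFree ↔ t.KontFree
  | _, _, _, var _ => Iff.rfl
  | _, _, ρ, app t s => and_congr (kontFree_rename ρ t) (kontFree_rename ρ s)
  | _, _, _, lam t => kontFree_rename _ t
  | _, _, _, cc => Iff.rfl
  | _, _, _, kont _ => Iff.rfl
  | _, _, _, instr _ => Iff.rfl

theorem kontFree_up {n : ℕ} (t : Closed A B) : (up t : Term A B n).KontFree ↔ t.KontFree :=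
  kontFree_rename _ t

end Term

/-! ### Typing rules -/

namespace Algebra

variable {𝒜 : Algebra.{u}}

infixl:70 " ⬝ " => Term.app

open Term

/-- The falsity value of an implication. -/
def impS (X Y : Set 𝒜.Stk) : Set 𝒜.Stk := {ρ | ∃ t ∈ 𝒜.verity X, ∃ π ∈ Y, ρ = .push t π}

/-- The falsity value of a conjunction. -/
def andS (X Y : Set 𝒜.Stk) : Set 𝒜.Stk := impS (impS X (impS Y Set.univ)) Set.univ

/-- The falsity value of an existential quantification. -/
def exS {ι : Sort*} (X : ι → Set 𝒜.Stk) : Set 𝒜.Stk := impS (⋃ i, impS (X i) Set.univ) Set.univ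

theorem pole_of_step {p q : 𝒜.Lam × 𝒜.Stk} (h : Step p q) (hq : q ∈ 𝒜.pole) : p ∈ 𝒜.pole :=
  𝒜.pole_closed _ _ (𝒜.red_of_step _ _ h) hq

theorem verity_anti {X Y : Set 𝒜.Stk} (h : X ⊆ Y) : 𝒜.verity Y ⊆ 𝒜.verity X :=
  fun _ ht _ hπ => ht _ (h hπ)

theorem mem_verity_iUnion {ι : Sort*} {X : ι → Set 𝒜.Stk} {t : 𝒜.Lam} :
    t ∈ 𝒜.verity (⋃ i, X i) ↔ ∀ i, t ∈ 𝒜.verity (X i) := by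
  simp only [verity, Set.mem_iUnion, Set.mem_ofPred_eq]
  exact ⟨fun h i π hπ => h π ⟨i, hπ⟩, fun h π ⟨i, hπ⟩ => h i π hπ⟩

theorem rz_app {X Y : Set 𝒜.Stk} {t s : 𝒜.Lam} (ht : t ∈ 𝒜.verity (impS X Y))
    (hs : s ∈ 𝒜.verity X) : t ⬝ s ∈ 𝒜.verity Y :=
  fun π hπ => pole_of_step (.push t s π) (ht _ ⟨s, hs, π, hπ, rfl⟩)

/-- With `rz_app`, this turns adequacy proofs into typing derivations: variables and applications
under `subst` unfold definitionally, and only the embedded closed terms need `subst_up`. -/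
theorem rz_lam {n : ℕ} {σ : Fin n → 𝒜.Lam} {t : Term 𝒜.A 𝒜.B (n + 1)} {X Y : Set 𝒜.Stk}
    (h : ∀ s ∈ 𝒜.verity X, subst (Matrix.vecCons s σ) t ∈ 𝒜.verity Y) :
    subst σ (lam t) ∈ 𝒜.verity (impS X Y) := by
  rintro _ ⟨s, hs, π, hπ, rfl⟩
  refine pole_of_step (.grab _ s π) ?_
  rw [inst_subst_lift]
  exact h s hs π hπ

theorem rz_up {n : ℕ} {σ : Fin n → 𝒜.Lam} {t : 𝒜.Lam} {X : Set 𝒜.Stk}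
    (h : t ∈ 𝒜.verity X) : subst σ (up t) ∈ 𝒜.verity X := by
  rwa [subst_up]

theorem rz_closed {t : 𝒜.Lam} {X : Set 𝒜.Stk} (h : subst ![] t ∈ 𝒜.verity X) :
    t ∈ 𝒜.verity X := by
  rwa [subst_closed] at h

end Algebra

/-! ### Realizers -/

namespace Term

variable {A B : Type u}

/-- Half of Turing's fixed point combinator. -/
def turing : Closed A B := lam (lam (var 0 ⬝ (var 1 ⬝ var 1 ⬝ var 0)))

/-- Turing's fixed point combinator. -/
def fixpt : Closed A B := turing ⬝ turing

/-- Reflexivity of `⊆`. -/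
def subRefl : Closed A B := fixpt ⬝ lam (lam (var 0 ⬝ var 1 ⬝ var 1))

/-- Transitivity of `⊆`. -/
def subTrans : Closed A B := fixpt ⬝ lam (lam (lam (lam (var 2 ⬝ lam (lam (var 3 ⬝ lam (lam
  (var 4 ⬝ (var 7 ⬝ var 3 ⬝ var 1) ⬝ (var 7 ⬝ var 0 ⬝ var 2)))))))))

/-- `x ∈ a` and `a ⊆ b` imply `x ∈ b`. -/
def memSub : Closed A B := lam (lam (lam (var 2 ⬝ lam (lam (var 3 ⬝ lam (lam
  (var 4 ⬝ (up subTrans ⬝ var 3 ⬝ var 1) ⬝ (up subTrans ⬝ var 0 ⬝ var 2))))))))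

/-- `a ∉ a`. -/
def memIrrefl : Closed A B := fixpt ⬝ lam (lam (lam (var 1 ⬝ var 2)))

/-- An element in the sense of the ground model is an element. -/
def memIntro : Closed A B := lam (var 0 ⬝ up subRefl ⬝ up subRefl)

/-- Transitivity of the name of a transitive set. -/
def reishTrans : Closed A B := lam (lam (lam (var 2 ⬝ lam (lam
  (up memSub ⬝ (up memSub ⬝ var 3 ⬝ var 1) ⬝ up subRefl ⬝ var 2)))))

/-- Transitivity of the elements of the name of a hereditarily transitive set. -/
def reishMemTrans : Closed A B := lam (lam (lam (lam (var 3 ⬝ lam (lam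
  (up memSub ⬝ (up reishTrans ⬝ (up memSub ⬝ var 4 ⬝ var 1) ⬝ var 3) ⬝ var 0 ⬝ var 2))))))

/-- Monotonicity of `∃` and of `∧` in its first argument. -/
def exMap : Closed A B := lam (lam (lam (var 1 ⬝ lam (var 1 ⬝ (var 3 ⬝ var 0)))))

/-- Monotonicity of `∧` in its second argument. -/
def andMapRight : Closed A B :=
  lam (lam (lam (var 1 ⬝ lam (lam (var 2 ⬝ var 1 ⬝ (var 4 ⬝ var 0))))))

/-- Introduction of `∧`. -/
def pair : Closed A B := lam (lam (lam (var 0 ⬝ var 2 ⬝ var 1)))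

/-- `x ⊆ y` and `y ⊆ x` and `z ≃ x` imply `z ≃ y`. -/
def eqvTrans : Closed A B := lam (lam (lam (lam (var 1 ⬝ lam (lam
  (var 2 ⬝ (up subTrans ⬝ var 1 ⬝ var 5) ⬝ (up subTrans ⬝ var 4 ⬝ var 0)))))))

/-- `x ⊆ y` and `y ⊆ x` and `s ≃ {x}` imply `s ≃ {y}`. -/
def singletonCongr : Closed A B := lam (lam (lam (lam (var 1 ⬝ lam (lam (var 2 ⬝
  lam (up eqvTrans ⬝ var 6 ⬝ var 5 ⬝ (var 2 ⬝ var 0)) ⬝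
  lam (var 1 ⬝ (up eqvTrans ⬝ var 5 ⬝ var 6 ⬝ var 0))))))))

/-- `x ⊆ y` and `y ⊆ x` and `⟨x, z⟩ ∈ f` imply `⟨y, z⟩ ∈ f`. -/
def relCongr : Closed A B := lam (lam (up exMap ⬝ (up andMapRight ⬝
  (up exMap ⬝ (up exMap ⬝ (up exMap ⬝ (up exMap ⬝ (up exMap ⬝
    (up exMap ⬝ (up singletonCongr ⬝ var 1 ⬝ var 0))))))))))

/-- The contradiction between the facts that the values of a function at `x` are unique and that
two given values are comparable. -/
def clash : Closed A B := lam (lam (lam (lam (var 3 ⬝ var 2 ⬝ (up pair ⬝ var 1 ⬝ var 0) ⬝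
  lam (lam (var 1 ⬝ up memIrrefl))) ⬝ var 0)))

/-- No function maps an element of `reish δ` onto `reish δ`. -/
def noSurj : Closed A B := lam (lam (var 1 ⬝ lam (lam (var 2 ⬝ lam (var 0 ⬝ lam (lam (var 1 ⬝
  lam (lam (var 2 ⬝ up memIntro ⬝ lam (var 0 ⬝ lam (lam (up memSub ⬝ var 1 ⬝ var 9 ⬝ lam (lam
    (up clash ⬝ var 5 ⬝ (up memSub ⬝ up memIntro ⬝ var 10) ⬝
      (up relCongr ⬝ var 1 ⬝ var 0 ⬝ var 2)))))))))))))))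

end Term

open Term in
theorem kontFree_realizer {A B : Type u} :
    (pair ⬝ (pair ⬝ reishTrans ⬝ reishMemTrans) ⬝ noSurj : Closed A B) ∈ realizers A B := by
  simp [realizers, KontFree, kontFree_up, pair, reishTrans, reishMemTrans, noSurj, clash, relCongr,
    singletonCongr, eqvTrans, andMapRight, exMap, memIntro, memIrrefl, memSub, subTrans, subRefl,
    fixpt, turing]

end Realizability

-- Realizing the extensional theory of names

namespace Realizability

namespace Algebra

variable {𝒜 : Algebra.{u}}

open Term

/-- The falsity value of `a ε̸ b`. -/
def notEpsS (a b : 𝒜.Names) : Set 𝒜.Stk := {π | Name.Mem a π b}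

/-- The falsity value of `a ∈ b`. -/
def memS (a b : 𝒜.Names) : Set 𝒜.Stk := impS (𝒜.falsityNotMem a b) Set.univ

/-- The falsity value of `a ≃ b`. -/
def eqvS (a b : 𝒜.Names) : Set 𝒜.Stk := andS (𝒜.falsitySub a b) (𝒜.falsitySub b a)

/-- Presents the recursive clause as the formula `∀ c (c ∉ b → c ε̸ a)`, to which the typing rules
apply. -/
theorem falsitySub_eq (a b : 𝒜.Names) :
    𝒜.falsitySub a b = ⋃ c, impS (𝒜.falsityNotMem c b) (notEpsS c a) := by
  ext ρ
  rw [falsitySub]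
  simp only [Set.mem_iUnion]
  exact ⟨fun ⟨c, π, t, h, ht, e⟩ => ⟨c, t, ht, π, h, e⟩,
    fun ⟨c, t, ht, π, h, e⟩ => ⟨c, π, t, h, ht, e⟩⟩

theorem falsityNotMem_eq (a b : 𝒜.Names) : 𝒜.falsityNotMem a b =
    ⋃ c, impS (𝒜.falsitySub a c) (impS (𝒜.falsitySub c a) (notEpsS c b)) := by
  ext ρ
  rw [falsityNotMem]
  simp only [Set.mem_iUnion]
  exact ⟨fun ⟨c, π, t, t', h, ht, ht', e⟩ => ⟨c, t, ht, _, ⟨t', ht', π, h, rfl⟩, e⟩,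
    fun ⟨c, t, ht, _, ⟨t', ht', π, h, rfl⟩, e⟩ => ⟨c, π, t, t', h, ht, ht', e⟩⟩

theorem rz_sub {a b : 𝒜.Names} {t : 𝒜.Lam} : t ∈ 𝒜.verity (𝒜.falsitySub a b) ↔
    ∀ c, t ∈ 𝒜.verity (impS (𝒜.falsityNotMem c b) (notEpsS c a)) := by
  rw [falsitySub_eq, mem_verity_iUnion]

theorem rz_notMem {a b : 𝒜.Names} {t : 𝒜.Lam} : t ∈ 𝒜.verity (𝒜.falsityNotMem a b) ↔
    ∀ c, t ∈ 𝒜.verity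
      (impS (𝒜.falsitySub a c) (impS (𝒜.falsitySub c a) (notEpsS c b))) := by
  rw [falsityNotMem_eq, mem_verity_iUnion]

/-! ### Induction and extensional equality -/

/-- The fixed point evaluates to its body with itself substituted, so a single term serves at every
stage of a well-founded induction. -/
theorem rz_fixpt {ι : Type*} {r : ι → ι → Prop} (hr : WellFounded r) (E : ι → Set 𝒜.Stk)
    {t : Term 𝒜.A 𝒜.B 1}
    (h : ∀ i, (∀ j, r j i → fixpt ⬝ lam t ∈ 𝒜.verity (E j)) →
      subst ![fixpt ⬝ lam t] t ∈ 𝒜.verity (E i)) (i : ι) :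
    fixpt ⬝ lam t ∈ 𝒜.verity (E i) := by
  induction i using hr.induction with | _ i ih =>
  intro π hπ
  -- Three steps unfold `turing ⬝ turing` up to its second abstraction; the other three reach `lam
  -- t` facing the fixed point and substitute it.
  refine pole_of_step (.push _ _ _) (pole_of_step (.push _ _ _) (pole_of_step (.grab _ _ _)
    (pole_of_step (.grab _ _ _) (pole_of_step (.push _ _ _) (pole_of_step (.grab _ _ _) ?_)))))
  have : t.inst (fixpt ⬝ lam t) = subst ![fixpt ⬝ lam t] t := by
    rw [inst]
    congr 1
    funext k
    rw [Subsingleton.elim k 0]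
    rfl
  change (t.inst (fixpt ⬝ lam t), π) ∈ 𝒜.pole
  exact this ▸ h i ih π hπ

/-- Stated for inclusion of names as sets, so that the same term also realizes `ℸx ⊆ ℸy` for `x ⊆
y`. -/
theorem rz_subRefl {a b : 𝒜.Names} (h : ∀ c π, Name.Mem c π a → Name.Mem c π b) :
    subRefl ∈ 𝒜.verity (𝒜.falsitySub a b) := by
  refine verity_anti ?_ (rz_fixpt Name.inDom_wf (fun a : 𝒜.Names =>
    ⋃ b : {b : 𝒜.Names // ∀ c π, Name.Mem c π a → Name.Mem c π b}, 𝒜.falsitySub a b) ?_ a)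
  · exact Set.subset_iUnion_of_subset ⟨b, h⟩ (Set.Subset.refl _)
  intro a ih
  refine mem_verity_iUnion.2 fun b => rz_sub.2 fun c => rz_lam fun t ht π hπ => ?_
  have hc := mem_verity_iUnion.1 (ih c ⟨π, hπ⟩) ⟨c, fun _ _ => id⟩
  exact rz_app (rz_app (rz_notMem.1 ht c) hc) hc π (b.2 c π hπ)

/-- Induction on the middle name: for `d ε a`, `e ε b`, `g ε c`, the chains `d ⊆ e ⊆ g` and `g ⊆ e ⊆
d` both pass through `e`. -/
theorem rz_subTrans {a b c : 𝒜.Names} {s t : 𝒜.Lam} (hs : s ∈ 𝒜.verity (𝒜.falsitySub a b))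
    (ht : t ∈ 𝒜.verity (𝒜.falsitySub b c)) :
    subTrans ⬝ s ⬝ t ∈ 𝒜.verity (𝒜.falsitySub a c) := by
  have key := rz_fixpt Name.inDom_wf (fun b : 𝒜.Names => ⋃ a, ⋃ c, impS (𝒜.falsitySub a b)
    (impS (𝒜.falsitySub b c) (𝒜.falsitySub a c)))
    (t := lam (lam (lam (var 2 ⬝ lam (lam (var 3 ⬝ lam (lam
      (var 4 ⬝ (var 7 ⬝ var 3 ⬝ var 1) ⬝ (var 7 ⬝ var 0 ⬝ var 2))))))))) ?_ b
  · exact rz_app (rz_app (mem_verity_iUnion.1 (mem_verity_iUnion.1 key a) c) hs) ht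
  intro b ih
  refine mem_verity_iUnion.2 fun a => mem_verity_iUnion.2 fun c => rz_lam fun s hs =>
    rz_lam fun t ht => rz_sub.2 fun d => rz_lam fun r hr => rz_app (rz_sub.1 hs d) ?_
  refine rz_notMem.2 fun e => rz_lam fun u hu => rz_lam fun u' hu' ρ hρ => ?_
  have ih {x y : 𝒜.Names} := mem_verity_iUnion.1 (mem_verity_iUnion.1 (ih e ⟨ρ, hρ⟩) x) y
  refine rz_app (rz_sub.1 ht e) ?_ ρ hρ
  exact rz_notMem.2 fun g => rz_lam fun w hw => rz_lam fun w' hw' =>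
    rz_app (rz_app (rz_notMem.1 hr g) (rz_app (rz_app ih hu) hw)) (rz_app (rz_app ih hw') hu')

theorem rz_memSub {x a b : 𝒜.Names} {s t : 𝒜.Lam} (hs : s ∈ 𝒜.verity (memS x a))
    (ht : t ∈ 𝒜.verity (𝒜.falsitySub a b)) : memSub ⬝ s ⬝ t ∈ 𝒜.verity (memS x b) := by
  refine rz_app (Y := memS x b) (rz_app (rz_closed (X := impS (memS x a) (impS (𝒜.falsitySub a b)
    (memS x b))) ?_) hs) ht
  refine rz_lam fun s hs => rz_lam fun t ht => rz_lam fun r hr => rz_app hs ?_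
  refine rz_notMem.2 fun e => rz_lam fun u hu => rz_lam fun u' hu' => rz_app (rz_sub.1 ht e) ?_
  refine rz_notMem.2 fun g => rz_lam fun w hw => rz_lam fun w' hw' =>
    rz_app (rz_app (rz_notMem.1 hr g) ?_) ?_
  · simp only [subst, subst_up]
    exact rz_subTrans hu hw
  · simp only [subst, subst_up]
    exact rz_subTrans hw' hu'

/-- If `c ε a` and `a ⊆ c`, the induction hypothesis `c ∉ c` contradicts `a ⊆ c` at `c`. -/
theorem rz_memIrrefl (a : 𝒜.Names) : memIrrefl ∈ 𝒜.verity (𝒜.falsityNotMem a a) := by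
  refine rz_fixpt Name.inDom_wf (fun a : 𝒜.Names => 𝒜.falsityNotMem a a) ?_ a
  intro a ih
  exact rz_notMem.2 fun c => rz_lam fun t ht => rz_lam fun t' _ π hπ =>
    rz_app (rz_sub.1 ht c) (ih c ⟨π, hπ⟩) π hπ

theorem rz_memIntro {c a : 𝒜.Names} (h : ∀ π, Name.Mem c π a) :
    memIntro ∈ 𝒜.verity (memS c a) := by
  refine rz_closed (rz_lam fun r hr => ?_)
  have hc : subRefl ∈ 𝒜.verity (𝒜.falsitySub c c) := rz_subRefl fun _ _ => id
  exact verity_anti (fun π _ => h π)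
    (rz_app (rz_app (rz_notMem.1 hr c) (rz_up hc)) (rz_up hc))

/-! ### Recursive names -/

theorem mem_reish {P : Type u} {x : ZFSet.{u}} {c : Name P} {π : P} :
    Name.Mem c π (reish P x) ↔ ∃ y ∈ x, c = reish P y := by
  rw [reish, Name.mem_ofSet]
  constructor
  · rintro ⟨⟨⟨y, hy⟩, ρ⟩, h⟩
    exact ⟨y, hy, (congrArg Prod.fst h).symm⟩
  · rintro ⟨y, hy, rfl⟩
    exact ⟨⟨⟨y, hy⟩, π⟩, rfl⟩

/-- Elements of `ℸx` carry every stack, so `c ε̸ ℸx` is `⊥` or `⊤`. To use `a ∈ ℸx` it is therefore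
enough to refute `a ≃ ℸy` uniformly in `y ∈ x`. -/
theorem rz_notMem_reish {a : 𝒜.Names} {x : ZFSet.{u}} {t : 𝒜.Lam}
    (h : ∀ y ∈ x, t ∈ 𝒜.verity (impS (𝒜.falsitySub a (reish _ y))
      (impS (𝒜.falsitySub (reish _ y) a) Set.univ))) :
    t ∈ 𝒜.verity (𝒜.falsityNotMem a (reish _ x)) := by
  rw [rz_notMem]
  rintro c _ ⟨s, hs, _, ⟨s', hs', π, hπ, rfl⟩, rfl⟩
  obtain ⟨y, hy, rfl⟩ := mem_reish.1 hπ
  exact h y hy _ ⟨s, hs, _, ⟨s', hs', π, trivial, rfl⟩, rfl⟩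

theorem rz_memIntro_reish {y x : ZFSet.{u}} (h : y ∈ x) :
    memIntro ∈ 𝒜.verity (memS (reish _ y) (reish _ x)) :=
  rz_memIntro fun _ => mem_reish.2 ⟨y, h, rfl⟩

theorem rz_subRefl_reish {x y : ZFSet.{u}} (h : x ⊆ y) :
    subRefl ∈ 𝒜.verity (𝒜.falsitySub (reish _ x) (reish _ y)) :=
  rz_subRefl fun _ _ hc => by
    obtain ⟨z, hz, rfl⟩ := mem_reish.1 hc
    exact mem_reish.2 ⟨z, h hz, rfl⟩

/-- `reish x` is not contained in `reish y` when `y ∈ x`. -/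
theorem rz_not_sub_reish {x y : ZFSet.{u}} (h : y ∈ x) {t : 𝒜.Lam}
    (ht : t ∈ 𝒜.verity (𝒜.falsitySub (reish _ x) (reish _ y))) :
    t ⬝ memIrrefl ∈ 𝒜.verity Set.univ :=
  verity_anti (fun _ _ => mem_reish.2 ⟨y, h, rfl⟩) (rz_app (rz_sub.1 ht (reish _ y))
    (rz_memIrrefl _))

theorem rz_reishTrans {x : ZFSet.{u}} (hx : x.IsTransitive) : reishTrans ∈ 𝒜.verity
    (⋃ a, impS (memS a (reish _ x)) (⋃ b, impS (memS b a) (memS b (reish _ x)))) := by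
  refine rz_closed (mem_verity_iUnion.2 fun a => rz_lam fun s hs => mem_verity_iUnion.2 fun b =>
    rz_lam fun t ht => rz_lam fun r hr => rz_app hs ?_)
  refine rz_notMem_reish fun y hy => rz_lam fun u hu => rz_lam fun u' _ => ?_
  simp only [subst, subst_up]
  exact rz_app (rz_memSub (rz_memSub ht hu) (rz_subRefl_reish (hx y hy))) hr

/-- Replace `a` by some `ℸy` with `a ≃ ℸy`, use transitivity of `ℸy`, and return along `ℸy ⊆ a`. -/
theorem rz_reishMemTrans {x : ZFSet.{u}} (hx : ∀ y ∈ x, y.IsTransitive) :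
    reishMemTrans ∈ 𝒜.verity (⋃ a, impS (memS a (reish _ x)) (⋃ b, impS (memS b a)
      (⋃ c, impS (memS c b) (memS c a)))) := by
  refine rz_closed (mem_verity_iUnion.2 fun a => rz_lam fun s hs => mem_verity_iUnion.2 fun b =>
    rz_lam fun t ht => mem_verity_iUnion.2 fun c => rz_lam fun r hr => rz_lam fun q hq =>
      rz_app hs ?_)
  refine rz_notMem_reish fun y hy => rz_lam fun u hu => rz_lam fun u' hu' => ?_
  simp only [subst, subst_up]
  have := rz_app (mem_verity_iUnion.1 (rz_reishTrans (hx y hy)) b) (rz_memSub ht hu)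
  exact rz_app (rz_memSub (rz_app (mem_verity_iUnion.1 this c) hr) hu') hq

/-! ### Congruence of ordered pairs -/

theorem rz_exMap {ι : Sort*} {X Y : ι → Set 𝒜.Stk} {f : 𝒜.Lam}
    (hf : ∀ i, f ∈ 𝒜.verity (impS (X i) (Y i))) :
    exMap ⬝ f ∈ 𝒜.verity (impS (exS X) (exS Y)) := by
  refine rz_app (rz_closed (X := impS (⋃ i, impS (X i) (Y i)) (impS (exS X) (exS Y))) ?_)
    (mem_verity_iUnion.2 hf)
  exact rz_lam fun f hf => rz_lam fun s hs => rz_lam fun k hk => rz_app hs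
    (mem_verity_iUnion.2 fun i => rz_lam fun x hx =>
      rz_app (mem_verity_iUnion.1 hk i) (rz_app (mem_verity_iUnion.1 hf i) hx))

/-- The encoded `X ∧ Z` is an encoded `∃` with one instance and `Z → ⊥` in place of the inner `⊥`,
hence the same term. -/
theorem rz_andMapLeft {X Y Z : Set 𝒜.Stk} {f : 𝒜.Lam} (hf : f ∈ 𝒜.verity (impS X Y)) :
    exMap ⬝ f ∈ 𝒜.verity (impS (andS X Z) (andS Y Z)) := by
  refine rz_app (rz_closed (X := impS (impS X Y) (impS (andS X Z) (andS Y Z))) ?_) hf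
  exact rz_lam fun f hf => rz_lam fun s hs => rz_lam fun k hk => rz_app hs
    (rz_lam fun x hx => rz_app hk (rz_app hf hx))

theorem rz_andMapRight {X Y Z : Set 𝒜.Stk} {f : 𝒜.Lam} (hf : f ∈ 𝒜.verity (impS X Y)) :
    andMapRight ⬝ f ∈ 𝒜.verity (impS (andS Z X) (andS Z Y)) := by
  refine rz_app (rz_closed (X := impS (impS X Y) (impS (andS Z X) (andS Z Y))) ?_) hf
  exact rz_lam fun f hf => rz_lam fun s hs => rz_lam fun k hk => rz_app hs
    (rz_lam fun x hx => rz_lam fun y hy => rz_app (rz_app hk hx) (rz_app hf hy))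

theorem rz_pair {X Y : Set 𝒜.Stk} {s t : 𝒜.Lam} (hs : s ∈ 𝒜.verity X) (ht : t ∈ 𝒜.verity Y) :
    pair ⬝ s ⬝ t ∈ 𝒜.verity (andS X Y) := by
  refine rz_app (rz_app (rz_closed (X := impS X (impS Y (andS X Y))) ?_) hs) ht
  exact rz_lam fun s hs => rz_lam fun t ht => rz_lam fun k hk => rz_app (rz_app hk hs) ht

theorem rz_eqvTrans {x y z : 𝒜.Names} {s t : 𝒜.Lam} (hs : s ∈ 𝒜.verity (𝒜.falsitySub x y))
    (ht : t ∈ 𝒜.verity (𝒜.falsitySub y x)) :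
    eqvTrans ⬝ s ⬝ t ∈ 𝒜.verity (impS (eqvS z x) (eqvS z y)) := by
  refine rz_app (rz_app (rz_closed (X := impS (𝒜.falsitySub x y) (impS (𝒜.falsitySub y x)
    (impS (eqvS z x) (eqvS z y)))) ?_) hs) ht
  refine rz_lam fun s hs => rz_lam fun t ht => rz_lam fun e he => rz_lam fun k hk => rz_app he
    (rz_lam fun p hp => rz_lam fun q hq => ?_)
  simp only [subst, subst_up]
  exact rz_app (rz_app hk (rz_subTrans hp hs)) (rz_subTrans ht hq)

/-- The falsity value of `s ≃ {x}`. -/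
def singletonS (s x : 𝒜.Names) : Set 𝒜.Stk :=
  ⋃ z, andS (impS (memS z s) (eqvS z x)) (impS (eqvS z x) (memS z s))

theorem rz_singletonCongr {x y a : 𝒜.Names} {s t : 𝒜.Lam}
    (hs : s ∈ 𝒜.verity (𝒜.falsitySub x y)) (ht : t ∈ 𝒜.verity (𝒜.falsitySub y x)) :
    singletonCongr ⬝ s ⬝ t ∈ 𝒜.verity (impS (singletonS a x) (singletonS a y)) := by
  refine rz_app (rz_app (rz_closed (X := impS (𝒜.falsitySub x y) (impS (𝒜.falsitySub y x)
    (impS (singletonS a x) (singletonS a y)))) ?_) hs) ht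
  refine rz_lam fun s hs => rz_lam fun t ht => rz_lam fun h hh => mem_verity_iUnion.2 fun z =>
    rz_lam fun k hk => rz_app (mem_verity_iUnion.1 hh z) (rz_lam fun i hi => rz_lam fun j hj =>
      rz_app (rz_app hk (rz_lam fun m hm => ?_)) (rz_lam fun m hm => rz_app hj ?_))
  · simp only [subst, subst_up]
    exact rz_app (rz_eqvTrans hs ht) (rz_app hi hm)
  · simp only [subst, subst_up]
    exact rz_app (rz_eqvTrans ht hs) hm

end Algebra
end Realizability

-- Function graphs, the counting argument and the absence of surjections

namespace Realizability

namespace Algebra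

variable {𝒜 : Algebra.{u}}

open Term

/-- The falsity value of `z = ∅`. -/
def emptyS (z : 𝒜.Names) : Set 𝒜.Stk := ⋃ x, impS (memS x z) Set.univ

/-- The falsity value of `s ≃ {x, y}`. -/
def pairS (s x y : 𝒜.Names) : Set 𝒜.Stk :=
  ⋃ z, andS (impS (memS z s)
      (impS (impS (eqvS z x) Set.univ) (impS (impS (eqvS z y) Set.univ) Set.univ)))
    (impS (impS (impS (eqvS z x) Set.univ) (impS (impS (eqvS z y) Set.univ) Set.univ))
      (memS z s))

/-- The falsity value of `p ≃ ⟨x, y⟩`. -/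
def orderedPairS (p x y : 𝒜.Names) : Set 𝒜.Stk :=
  exS fun a => exS fun b => exS fun c => exS fun d => exS fun e =>
    andS (singletonS a x) (andS (emptyS b) (andS (pairS c a b) (andS (singletonS d y)
      (andS (singletonS e d) (pairS p c e)))))

/-- The falsity value of `⟨x, y⟩ ∈ f`. -/
def relS (f x y : 𝒜.Names) : Set 𝒜.Stk := exS fun p => andS (memS p f) (orderedPairS p x y)

/-- In `⟨x, y⟩ ∈ f` the name `x` occurs only in the clause `a ≃ {x}`; all existential witnesses are
kept. -/
theorem rz_relCongr {f x x' y : 𝒜.Names} {s t g : 𝒜.Lam}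
    (hs : s ∈ 𝒜.verity (𝒜.falsitySub x x')) (ht : t ∈ 𝒜.verity (𝒜.falsitySub x' x))
    (hg : g ∈ 𝒜.verity (relS f x y)) : relCongr ⬝ s ⬝ t ⬝ g ∈ 𝒜.verity (relS f x' y) := by
  refine rz_app (rz_app (rz_app (rz_closed (X := impS (𝒜.falsitySub x x') (impS
    (𝒜.falsitySub x' x) (impS (relS f x y) (relS f x' y)))) ?_) hs) ht) hg
  refine rz_lam fun s hs => rz_lam fun t ht => ?_
  simp only [subst, subst_up]
  exact rz_exMap fun p => rz_andMapRight (rz_exMap fun a => rz_exMap fun b => rz_exMap fun c =>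
    rz_exMap fun d => rz_exMap fun e => rz_andMapLeft (rz_singletonCongr hs ht))

/-- The uniqueness of the value at `x` of a function `f` refutes that it takes two values at `x`
which are the names of a set and of one of its elements. -/
theorem rz_clash {b f x : 𝒜.Names} {ι : Type*} {z : ZFSet.{u}} {w : ι → ZFSet.{u}}
    (hw : ∀ i, w i ∈ z) {h e g : 𝒜.Lam}
    (hh : h ∈ 𝒜.verity (⋃ x, impS (memS x b) (⋃ y, ⋃ y', impS (andS (relS f x y) (relS f x y'))
      (eqvS y y'))))
    (he : e ∈ 𝒜.verity (memS x b)) (hg : g ∈ 𝒜.verity (relS f x (reish _ z)))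
    (hz : impS (relS f x (reish _ z)) Set.univ ⊆ ⋃ i, impS (relS f x (reish _ (w i))) Set.univ) :
    clash ⬝ h ⬝ e ⬝ g ∈ 𝒜.verity Set.univ := by
  refine rz_app (rz_app (rz_app (rz_closed (X := impS (⋃ x, impS (memS x b) (⋃ y, ⋃ y',
    impS (andS (relS f x y) (relS f x y')) (eqvS y y'))) (impS (memS x b) (impS
      (relS f x (reish _ z)) Set.univ))) ?_) hh) he) hg
  refine rz_lam fun h hh => rz_lam fun e he => rz_lam fun g hg =>
    -- One term refutes `f(x, ℸ(w i))` for all `i` at once, so by `hz` it refutes `f(x, ℸz)`, which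
    -- `g` realizes.
    rz_app (verity_anti hz (mem_verity_iUnion.2 fun i => rz_lam fun g' hg' => ?_)) hg
  have hu := mem_verity_iUnion.1 (mem_verity_iUnion.1 (rz_app (mem_verity_iUnion.1 hh x) he)
    (reish _ z)) (reish _ (w i))
  refine rz_app (rz_app hu ?_) (rz_lam fun p hp => rz_lam fun q _ => ?_)
  · simp only [subst, subst_up]
    exact rz_pair hg hg'
  · simp only [subst, subst_up]
    exact rz_not_sub_reish (hw i) hp

/-- Below an uncountable cardinal larger than the number of "colours" there is an ordinal all of
whose colours occur already below it. -/
theorem exists_ordinal_reflecting {S : Type u} {δ : Cardinal.{u}} (hS : Cardinal.mk S < δ)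
    (hδ : Cardinal.aleph0 < δ) {β : Ordinal.{u}} (hβ : β < δ.ord)
    (P : Ordinal.{u} → S → Ordinal.{u} → Prop) :
    ∃ η < δ.ord, ∀ γ < β, ∀ s, P γ s η → ∃ η' < η, P γ s η' := by
  classical
  -- Since `δ` may be singular, the search is confined below the regular cardinal `κ⁺ ≤ δ`.
  obtain ⟨κ, hκ⟩ : ∃ κ, κ = max Cardinal.aleph0 (max (Cardinal.mk S) β.card) := ⟨_, rfl⟩
  have hκ0 : Cardinal.aleph0 ≤ κ := hκ ▸ le_max_left _ _
  have hκS : Cardinal.mk S ≤ κ := hκ ▸ (le_max_left _ _).trans (le_max_right _ _)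
  have hκβ : β.card ≤ κ := hκ ▸ (le_max_right _ _).trans (le_max_right _ _)
  have hκδ : Order.succ κ ≤ δ := Order.succ_le_of_lt
    (hκ ▸ max_lt hδ (max_lt hS (Cardinal.lt_ord.1 hβ)))
  have hreg := Cardinal.isRegular_succ hκ0
  let Q (i : β.ToType × S) (η : Ordinal.{u}) : Prop :=
    η < (Order.succ κ).ord ∧ P (Ordinal.ToType.mk.symm i.1).1 i.2 η
  -- A witness below `κ⁺` for each pair; the default `0` is harmless.
  let F (i : β.ToType × S) : Ordinal.{u} := if h : ∃ η, Q i η then h.choose else 0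
  have hpos : 0 < (Order.succ κ).ord := by
    rw [Cardinal.lt_ord, Ordinal.card_zero]
    exact (Cardinal.aleph0_pos.trans_le hκ0).trans_le (Order.le_succ κ)
  have hF (i) : F i < (Order.succ κ).ord := by
    by_cases h : ∃ η, Q i η
    · simp only [F, dif_pos h]
      exact h.choose_spec.1
    · simpa only [F, dif_neg h] using hpos
  -- At most `κ` pairs cannot be cofinal in `κ⁺`; the `+ 1` puts every witness strictly below the
  -- supremum.
  have hlt : (⨆ i, (F i + 1)) < (Order.succ κ).ord := by
    refine Ordinal.iSup_lt_of_lt_cof ?_ fun i => ?_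
    · rw [hreg.cof_ord, Cardinal.mk_prod, Cardinal.lift_id, Cardinal.lift_id, Cardinal.mk_toType]
      exact Order.lt_succ_of_le (Cardinal.mul_le_of_le hκ0 hκβ hκS)
    · exact (Cardinal.isSuccLimit_ord hreg.aleph0_le).succ_lt (hF i)
  refine ⟨_, hlt.trans_le (Cardinal.ord_le_ord.2 hκδ), fun γ hγ s hP => ?_⟩
  -- The supremum itself shows that a witness exists, so `F` did not take its default value here.
  have hex : ∃ η, Q (Ordinal.ToType.mk ⟨γ, hγ⟩, s) η := ⟨_, hlt, by simpa using hP⟩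
  refine ⟨F (Ordinal.ToType.mk ⟨γ, hγ⟩, s), ?_, ?_⟩
  · exact (Order.lt_add_one_iff.2 le_rfl).trans_le (Ordinal.le_iSup (fun i => F i + 1) _)
  · simp only [F, dif_pos hex]
    simpa using hex.choose_spec.2

theorem aleph0_le_mk_closed (A B : Type u) : Cardinal.aleph0 ≤ Cardinal.mk (Closed A B) := by
  rw [← Cardinal.infinite_iff]
  refine Infinite.of_injective (fun n : ℕ => (fun t : Closed A B => cc ⬝ t)^[n] cc) ?_
  intro m
  induction m with
  | zero =>
    intro n h
    cases n with
    | zero => rfl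
    | succ n => simp [Function.iterate_succ_apply'] at h
  | succ m ih =>
    intro n h
    cases n with
    | zero => simp [Function.iterate_succ_apply'] at h
    | succ n =>
      simp only [Function.iterate_succ_apply', app.injEq, true_and] at h
      exact congrArg _ (ih h)

/-- Continuation constants embed stacks into closed terms, so `δ > |Λ|` bounds the number of
colours. -/
theorem mk_stack_le (A B : Type u) : Cardinal.mk (Stack A B) ≤ Cardinal.mk (Closed A B) :=
  Cardinal.mk_le_of_injective (f := fun π => (kont π : Closed A B)) fun _ _ h => by
    simpa using h

theorem rz_noSurj {δ : Cardinal.{u}} (hδ : Cardinal.mk 𝒜.Lam < δ) (b : 𝒜.Names) :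
    noSurj ∈ 𝒜.verity (impS (memS b (reish _ δ.ord.toZFSet)) (impS (exS fun f => andS
      (andS (⋃ x, impS (memS x b) (exS fun y => relS f x y))
        (⋃ x, impS (memS x b) (⋃ y, ⋃ y', impS (andS (relS f x y) (relS f x y')) (eqvS y y'))))
      (⋃ y, impS (memS y (reish _ δ.ord.toZFSet)) (exS fun x => andS (memS x b) (relS f x y))))
      Set.univ)) := by
  refine rz_closed (rz_lam fun s hs => rz_lam fun q hq => rz_app hs ?_)
  refine rz_notMem_reish fun B hB => rz_lam fun u hu => rz_lam fun u' hu' => ?_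
  obtain ⟨β, hβ, rfl⟩ := Ordinal.mem_toZFSet_iff.1 hB
  refine rz_app hq (mem_verity_iUnion.2 fun f => rz_lam fun h hh => rz_app hh
    (rz_lam fun fu hfu => rz_lam fun su hsu => rz_app hfu
      (rz_lam fun tot _ => rz_lam fun un hun => ?_)))
  -- The ordinal `η` depends on `f` and `β`, but the realizer does not: `memIntro` proves `ℸη ∈ ℸδ`
  -- for every `η < δ`.
  obtain ⟨η, hη, hrefl⟩ := exists_ordinal_reflecting ((mk_stack_le _ _).trans_lt hδ)
    ((aleph0_le_mk_closed _ _).trans_lt hδ) hβ fun γ (π : 𝒜.Stk) η =>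
      π ∈ impS (relS f (reish _ γ.toZFSet) (reish _ η.toZFSet)) Set.univ
  refine rz_app (rz_app (mem_verity_iUnion.1 hsu (reish _ η.toZFSet))
    (rz_up (rz_memIntro_reish (Ordinal.toZFSet_mem_toZFSet_iff.2 hη))))
    (mem_verity_iUnion.2 fun x => rz_lam fun z hz => rz_app hz
      (rz_lam fun p hp => rz_lam fun g hg => ?_))
  -- From `x ∈ b ⊆ ℸβ`, pass to `γ < β` with `x ≃ ℸγ`.
  refine rz_app (X := 𝒜.falsityNotMem x (reish _ β.toZFSet)) ?_
    (rz_notMem_reish fun C hC => rz_lam fun w hw => rz_lam fun w' hw' => ?_)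
  · simp only [subst, subst_up]
    exact rz_memSub hp hu
  obtain ⟨γ, hγ, rfl⟩ := Ordinal.mem_toZFSet_iff.1 hC
  simp only [subst, subst_up]
  -- The reflecting property of `η` at `γ` is exactly the inclusion of falsity values required here.
  refine rz_clash (ι := Set.Iio η) (w := fun i => i.1.toZFSet)
    (fun i => Ordinal.toZFSet_mem_toZFSet_iff.2 i.2) hun
    (rz_memSub (rz_memIntro_reish hC) hu') (rz_relCongr hw hw' hg) fun π hπ => ?_
  obtain ⟨η', hη', h⟩ := hrefl γ hγ π hπ
  exact Set.mem_iUnion.2 ⟨⟨η', hη'⟩, h⟩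

/-! ### Falsity values of the formulas -/

section

variable (φ ψ : Fml) (v : ℕ → 𝒜.Names) (x y : ℕ)

theorem falsity_bot : 𝒜.falsity .bot v = Set.univ := rfl

theorem falsity_imp : 𝒜.falsity (.imp φ ψ) v = impS (𝒜.falsity φ v) (𝒜.falsity ψ v) := rfl

theorem falsity_and : 𝒜.falsity (.and φ ψ) v = andS (𝒜.falsity φ v) (𝒜.falsity ψ v) := rfl

theorem falsity_all :
    𝒜.falsity (.all x φ) v = ⋃ a, 𝒜.falsity φ (Function.update v x a) := rfl

theorem falsity_ex :
    𝒜.falsity (.ex x φ) v = exS fun a => 𝒜.falsity φ (Function.update v x a) := rfl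

theorem falsity_mem : 𝒜.falsity (.mem x y) v = memS (v x) (v y) := rfl

theorem falsity_eqv : 𝒜.falsity (.eqv x y) v = eqvS (v x) (v y) := rfl

end

theorem falsity_isEmpty (k z : ℕ) (v : ℕ → 𝒜.Names) (hz : z < k) :
    𝒜.falsity (.isEmpty k z) v = emptyS (v z) := by
  simp (disch := omega) only [Fml.isEmpty, Fml.neg, falsity_imp, falsity_all, falsity_bot,
    falsity_mem, Function.update_self, Function.update_of_ne, emptyS]

theorem falsity_isSingleton (k s x : ℕ) (v : ℕ → 𝒜.Names) (hs : s < k) (hx : x < k) :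
    𝒜.falsity (.isSingleton k s x) v = singletonS (v s) (v x) := by
  simp (disch := omega) only [Fml.isSingleton, Fml.iff, falsity_imp, falsity_and, falsity_all,
    falsity_mem, falsity_eqv, Function.update_self, Function.update_of_ne, singletonS]

theorem falsity_isPair (k s x y : ℕ) (v : ℕ → 𝒜.Names) (hs : s < k) (hx : x < k) (hy : y < k) :
    𝒜.falsity (.isPair k s x y) v = pairS (v s) (v x) (v y) := by
  simp (disch := omega) only [Fml.isPair, Fml.iff, Fml.or, falsity_imp, falsity_and, falsity_all,
    falsity_bot, falsity_mem, falsity_eqv, Function.update_self, Function.update_of_ne, pairS]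

theorem falsity_isOrderedPair (k p x y : ℕ) (v : ℕ → 𝒜.Names) (hp : p < k) (hx : x < k)
    (hy : y < k) : 𝒜.falsity (.isOrderedPair k p x y) v = orderedPairS (v p) (v x) (v y) := by
  simp (disch := omega) only [Fml.isOrderedPair, falsity_and, falsity_ex, falsity_isEmpty,
    falsity_isSingleton, falsity_isPair, Function.update_self, Function.update_of_ne, orderedPairS]

theorem falsity_related (k f x y : ℕ) (v : ℕ → 𝒜.Names) (hf : f < k) (hx : x < k) (hy : y < k) :
    𝒜.falsity (.related k f x y) v = relS (v f) (v x) (v y) := by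
  simp (disch := omega) only [Fml.related, Fml.exIn, falsity_and, falsity_ex, falsity_mem,
    falsity_isOrderedPair, Function.update_self, Function.update_of_ne, relS]

/-- Variable `0` holds `a` and bound variables start at `1`, so no capture occurs; `omega` separates
the indices. -/
theorem falsity_isCardinal (a : 𝒜.Names) :
    𝒜.falsity (.isCardinal 1 0) (fun _ => a) =
      andS (andS (⋃ x, impS (memS x a) (⋃ y, impS (memS y x) (memS y a)))
        (⋃ x, impS (memS x a) (⋃ y, impS (memS y x) (⋃ z, impS (memS z y) (memS z x)))))
      (⋃ b, impS (memS b a) (impS (exS fun f => andS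
        (andS (⋃ x, impS (memS x b) (exS fun y => relS f x y))
          (⋃ x, impS (memS x b) (⋃ y, ⋃ y', impS (andS (relS f x y) (relS f x y')) (eqvS y y'))))
        (⋃ y, impS (memS y a) (exS fun x => andS (memS x b) (relS f x y)))) Set.univ)) := by
  simp (disch := omega) only [Fml.isCardinal, Fml.isOrdinal, Fml.isTransitive, Fml.isFunction,
    Fml.isSurjection, Fml.allIn, Fml.exIn, Fml.neg, falsity_bot, falsity_imp, falsity_and,
    falsity_all, falsity_ex, falsity_mem, falsity_eqv, falsity_related, Function.update_self,
    Function.update_of_ne]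

end Algebra
end Realizability

theorem mainTheorem5 (𝒜 : Realizability.Algebra.{u}) (δ : Cardinal.{u})
    (hinf : Cardinal.aleph0 ≤ δ) (hδ : Cardinal.mk 𝒜.Lam < δ) :
    𝒜.Forces (Realizability.Fml.isCardinal 1 0)
      (fun _ => Realizability.reish 𝒜.Stk δ.ord.toZFSet) := by
  open Realizability Algebra in
  refine ⟨_, kontFree_realizer, ?_⟩
  have hord := ZFSet.isOrdinal_toZFSet δ.ord
  rw [Realizes, falsity_isCardinal]
  exact rz_pair (rz_pair (rz_reishTrans hord.isTransitive)
    (rz_reishMemTrans fun y hy => (hord.mem hy).isTransitive))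
    (mem_verity_iUnion.2 fun b => rz_noSurj hδ b)
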